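/- Let $\lambda = 1+\sqrt2$ and let $\sigma$ be the substitution $a\mapsto aaaaabb$, $b\mapsto baa$ on $\{a,b\}$. Its substitution matrix $\left(\begin{smallmatrix}5&2\\2&1\end{smallmatrix}\right)$ has Perron--Frobenius eigenvalue $\lambda^2=3+2\sqrt2$ with positive left eigenvector $(\lambda,1)$: every other eigenvalue has modulus smaller than $\lambda^2$. A finite word is *legal* if it is a subword of $\sigma^n(a)$ or $\sigma^n(b)$ for some $n\ge 0$. A *tiling induced by $\sigma$* is a tiling of $\mathbb R$ by a bi-infinite sequence of consecutive intervals (tiles) of types $a$ and $b$, of lengths $\lambda$ and $1$ respectively, such that every finite word of types of consecutive tiles is legal. (This includes the tilings given by the bi-infinite fixed points, with legal seed, of powers of $\sigma$.) For such a tiling let $\Lambda_\alpha$ be the set of left endpoints of the tiles of type $\alpha\in\{a,b\}$, let $\Lambda=\Lambda_a\cup\Lambda_b$, let $B_r(0)=(-r,r)$, and let $$\nu_{\alpha\beta}(z)=\lim_{r\to\infty}\frac{\operatorname{card}\{x\in\Lambda_\alpha\cap B_r(0) : x+z\in\Lambda_\beta\}}{\operatorname{card}(\Lambda\cap B_r(0))}$$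 be its pair correlations. **Theorem.** Tilings induced by $\sigma$ exist. For every such tiling, the limits $\nu_{\alpha\beta}(z)$ exist for all $\alpha,\beta\in\{a,b\}$ and all $z\in\mathbb R$, and for all $z\in\mathbb R$ (in particular for all $z\in\mathbb Z[\sqrt2]$) they satisfy $$\begin{aligned} \lambda^{2}\nu_{aa}(z) ={}& 5\nu_{aa}\bigl(\tfrac{z}{\lambda^2}\bigr)+4\nu_{aa}\bigl(\tfrac{z-\lambda}{\lambda^2}\bigr)+4\nu_{aa}\bigl(\tfrac{z+\lambda}{\lambda^2}\bigr)+3\nu_{aa}\bigl(\tfrac{z-2\lambda}{\lambda^2}\bigr)+3\nu_{aa}\bigl(\tfrac{z+2\lambda}{\lambda^2}\bigr)\\ &+2\nu_{aa}\bigl(\tfrac{z-3\lambda}{\lambda^2}\bigr)+2\nu_{aa}\bigl(\tfrac{z+3\lambda}{\lambda^2}\bigr)+\nu_{aa}\bigl(\tfrac{z-4\lambda}{\lambda^2}\bigr)+\nu_{aa}\bigl(\tfrac{z+4\lambda}{\lambda^2}\bigr)\\ &+\nu_{ab}\bigl(\tfrac{z-\lambda-1}{\lambda^2}\bigr)+2\nu_{ab}\bigl(\tfrac{z-1}{\lambda^2}\bigr)+2\nu_{ab}\bigl(\tfrac{z+\lambda-1}{\lambda^2}\bigr)+2\nu_{ab}\bigl(\tfrac{z+2\lambda-1}{\lambda^2}\bigr)+2\nu_{ab}\bigl(\tfrac{z+3\lambda-1}{\lambda^2}\bigr)+\nu_{ab}\bigl(\tfrac{z+4\lambda-1}{\lambda^2}\bigr)\\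 &+\nu_{ba}\bigl(\tfrac{z+\lambda+1}{\lambda^2}\bigr)+2\nu_{ba}\bigl(\tfrac{z+1}{\lambda^2}\bigr)+2\nu_{ba}\bigl(\tfrac{z-\lambda+1}{\lambda^2}\bigr)+2\nu_{ba}\bigl(\tfrac{z-2\lambda+1}{\lambda^2}\bigr)+2\nu_{ba}\bigl(\tfrac{z-3\lambda+1}{\lambda^2}\bigr)+\nu_{ba}\bigl(\tfrac{z-4\lambda+1}{\lambda^2}\bigr)\\ &+2\nu_{bb}\bigl(\tfrac{z}{\lambda^2}\bigr)+\nu_{bb}\bigl(\tfrac{z-\lambda}{\lambda^2}\bigr)+\nu_{bb}\bigl(\tfrac{z+\lambda}{\lambda^2}\bigr),\\[2mm] \lambda^{2}\nu_{bb}(z) ={}& 2\nu_{aa}\bigl(\tfrac{z}{\lambda^2}\bigr)+\nu_{aa}\bigl(\tfrac{z-1}{\lambda^2}\bigr)+\nu_{aa}\bigl(\tfrac{z+1}{\lambda^2}\bigr)+\nu_{ab}\bigl(\tfrac{z+5\lambda}{\lambda^2}\bigr)+\nu_{ab}\bigl(\tfrac{z+5\lambda+1}{\lambda^2}\bigr)\\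 &+\nu_{ba}\bigl(\tfrac{z-5\lambda}{\lambda^2}\bigr)+\nu_{ba}\bigl(\tfrac{z-5\lambda-1}{\lambda^2}\bigr)+\nu_{bb}\bigl(\tfrac{z}{\lambda^2}\bigr),\\[2mm] \lambda^{2}\nu_{ab}(z) ={}& \sum_{k=1}^{5}\Bigl[\nu_{aa}\bigl(\tfrac{z-k\lambda}{\lambda^2}\bigr)+\nu_{aa}\bigl(\tfrac{z-k\lambda-1}{\lambda^2}\bigr)\Bigr]+\sum_{k=0}^{4}\nu_{ab}\bigl(\tfrac{z+k\lambda}{\lambda^2}\bigr)\\ &+\nu_{ba}\bigl(\tfrac{z-4\lambda}{\lambda^2}\bigr)+\nu_{ba}\bigl(\tfrac{z-5\lambda}{\lambda^2}\bigr)+\nu_{ba}\bigl(\tfrac{z+1-4\lambda}{\lambda^2}\bigr)+\nu_{ba}\bigl(\tfrac{z+1-5\lambda}{\lambda^2}\bigr)+\nu_{bb}\bigl(\tfrac{z+1}{\lambda^2}\bigr)+\nu_{bb}\bigl(\tfrac{z+\lambda+1}{\lambda^2}\bigr), \end{aligned}$$ together with $\nu_{ba}(z)=\nu_{ab}(-z)$.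 Moreover, for all $\alpha,\beta\in\{a,b\}$, $\nu_{\alpha\beta}(z)=0$ whenever $z\notin\Lambda_\beta-\Lambda_\alpha=\{y-x : x\in\Lambda_\alpha,\ y\in\Lambda_\beta\}$. -/

import Mathlib

open scoped Pointwise

/-- The two-letter alphabet. -/
inductive Letter where
  | a
  | b
  deriving DecidableEq

instance : Fintype Letter where
  elems := {.a, .b}
  complete := fun c => by cases c <;> simp

/-- The substitution `a ↦ aaaaabb`, `b ↦ baa`, on letters. -/
def sigma : Letter → List Letter
  | .a => [.a, .a, .a, .a, .a, .b, .b]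
  | .b => [.b, .a, .a]

/-- The substitution on finite words, by concatenation. -/
def sigmaWord (w : List Letter) : List Letter := w.flatMap sigma

/-- A finite word is legal if it occurs in some iterate of the substitution on a single letter. -/
def IsLegal (u : List Letter) : Prop :=
  ∃ (c : Letter) (n : ℕ), u <:+: sigmaWord^[n] [c]

/-- The substitution matrix: the entry at `(i, j)` is the number of letters `i` in `sigma j`. -/
def sigmaMatrix : Matrix Letter Letter ℝ :=
  Matrix.of fun i j => ((sigma j).count i : ℝ)

/-- The number `λ = 1 + √2`. -/
noncomputable def lam : ℝ := 1 + √2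

/-- The natural tile lengths: a tile of type `a` has length `λ`, a tile of type `b` has
length `1`. -/
noncomputable def tileLength : Letter → ℝ
  | .a => lam
  | .b => 1

/-- A tiling of the real line induced by the substitution: a bi-infinite sequence of tiles
(closed intervals), in which the `n`-th tile has type `letter n`, left endpoint `pos n` and the
natural length of its type, consecutive tiles being adjacent, such that every finite word read off
from consecutive tiles is legal. This comprises the tilings that arise from the bi-infinite fixed
points (with a legal seed) of the powers of the substitution, and all their translates. -/
structure SigmaTiling where
  letter : ℤ → Letter
  pos : ℤ → ℝ
  pos_succ : ∀ n : ℤ, pos (n + 1) = pos n + tileLength (letter n)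
  legal : ∀ (n : ℤ) (k : ℕ), IsLegal ((List.range k).map fun i : ℕ => letter (n + i))

namespace SigmaTiling

/-- `Λ_α`, the set of control points (left endpoints) of the tiles of type `α`. -/
def points (T : SigmaTiling) (α : Letter) : Set ℝ :=
  {x | ∃ n : ℤ, T.letter n = α ∧ T.pos n = x}

/-- `Λ`, the set of all control points. -/
def allPoints (T : SigmaTiling) : Set ℝ := ⋃ α, T.points α

/-- The number of `x ∈ Λ_α ∩ B_r(0)` with `x + z ∈ Λ_β`, relative to the number of points
of `Λ ∩ B_r(0)`. -/
noncomputable def pairFreq (T : SigmaTiling) (α β : Letter) (z r : ℝ) : ℝ :=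
  ({x | x ∈ T.points α ∩ Metric.ball 0 r ∧ x + z ∈ T.points β}.ncard : ℝ) /
    ((T.allPoints ∩ Metric.ball 0 r).ncard : ℝ)

/-- The pair correlation `ν_{αβ}(z)`, the limit of the relative frequencies as `r → ∞`. -/
noncomputable def nu (T : SigmaTiling) (α β : Letter) (z : ℝ) : ℝ :=
  Filter.limUnder Filter.atTop (T.pairFreq α β z)

end SigmaTiling

open Filter Topology

/-! The number of pairs of tiles of given types at distance `z` in a word is additive under
concatenation up to `2 * |z|`, because only pairs straddling the seam are missed
(`almostAdditive_pairCount`). For any such function the values on the supertiles `σⁿ(a)`, `σⁿ(b)`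
obey the recursion of the substitution matrix up to a bounded error. Its eigenvalues are `λ²` and
`λ⁻² = 5 - 2λ`: the contracting component stays bounded, and the expanding one, divided by `λ²ⁿ`, is
Cauchy. A legal word is a concatenation of level-`n` supertiles apart from two ends of bounded
length, so the function has a density per unit length that is uniform over all long legal words
(`AlmostAdditive.exists_density`).

The tiles of a tiling with left endpoint in `B_r(0)` spell a legal word, up to a bounded number of
pairs leaving the ball. Hence `ν` exists, does not depend on the tiling, and is the density of pairs
divided by the density of points.

The renormalisation equations hold exactly for finite words (`pairCount_sigmaWord`): each tile of
`σ(w)` has a parent in `w` and an offset in the image of that parent. Dividing by `λ²ⁿ` along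
supertiles gives the equations for the densities. As the identity is used on words `σ(w)` only,
unique desubstitution of the tiling is never needed. -/

lemma lam_sq : lam ^ 2 = 2 * lam + 1 := by
  have h : √2 ^ 2 = (2 : ℝ) := Real.sq_sqrt (by norm_num)
  unfold lam
  linear_combination h

lemma two_lt_lam : 2 < lam := by
  have h : (1 : ℝ) < √2 := Real.lt_sqrt_of_sq_lt (by norm_num)
  unfold lam
  linarith

lemma lam_pos : 0 < lam := by linarith [two_lt_lam]

lemma one_le_tileLength (c : Letter) : 1 ≤ tileLength c := by
  cases c
  · exact le_of_lt (by linarith [two_lt_lam] : 1 < lam)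
  · exact le_rfl

lemma tileLength_le (c : Letter) : tileLength c ≤ lam := by
  cases c
  · exact le_rfl
  · exact le_of_lt (by linarith [two_lt_lam] : 1 < lam)

/-! ### Words and their natural lengths -/

/-- The total length of the tiles of a word. -/
noncomputable def wordLength (w : List Letter) : ℝ := (w.map tileLength).sum

@[simp] lemma wordLength_nil : wordLength [] = 0 := rfl

@[simp] lemma wordLength_cons (c : Letter) (w : List Letter) :
    wordLength (c :: w) = tileLength c + wordLength w := by
  simp [wordLength]

@[simp] lemma wordLength_append (u v : List Letter) :
    wordLength (u ++ v) = wordLength u + wordLength v := by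
  simp [wordLength]

lemma length_le_wordLength (w : List Letter) : (w.length : ℝ) ≤ wordLength w := by
  induction w with
  | nil => simp
  | cons c w ih =>
    have := one_le_tileLength c
    simp only [List.length_cons, Nat.cast_add, Nat.cast_one, wordLength_cons]
    linarith

lemma wordLength_nonneg (w : List Letter) : 0 ≤ wordLength w :=
  le_trans (Nat.cast_nonneg _) (length_le_wordLength w)

lemma wordLength_le (w : List Letter) : wordLength w ≤ lam * w.length := by
  induction w with
  | nil => simp
  | cons c w ih =>
    have := tileLength_le c
    simp only [List.length_cons, Nat.cast_add, Nat.cast_one, wordLength_cons]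
    linarith

lemma wordLength_sigma (c : Letter) : wordLength (sigma c) = lam ^ 2 * tileLength c := by
  cases c
  · simp only [sigma, wordLength_cons, tileLength, wordLength_nil]
    linear_combination (-lam - 2) * lam_sq
  · simp only [sigma, wordLength_cons, tileLength, wordLength_nil]
    linear_combination (-1) * lam_sq

@[simp] lemma sigmaWord_nil : sigmaWord [] = [] := rfl

lemma sigmaWord_cons (c : Letter) (w : List Letter) :
    sigmaWord (c :: w) = sigma c ++ sigmaWord w := by
  simp [sigmaWord]

lemma sigmaWord_append (u v : List Letter) :
    sigmaWord (u ++ v) = sigmaWord u ++ sigmaWord v := by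
  simp [sigmaWord]

lemma wordLength_sigmaWord (w : List Letter) :
    wordLength (sigmaWord w) = lam ^ 2 * wordLength w := by
  induction w with
  | nil => simp
  | cons c w ih =>
    rw [sigmaWord_cons, wordLength_append, ih, wordLength_sigma, wordLength_cons]
    ring

lemma wordLength_iterate (n : ℕ) (w : List Letter) :
    wordLength (sigmaWord^[n] w) = (lam ^ 2) ^ n * wordLength w := by
  induction n with
  | zero => simp
  | succ n ih =>
    rw [Function.iterate_succ_apply', wordLength_sigmaWord, ih]
    ring

lemma iterate_append (n : ℕ) (u v : List Letter) :
    sigmaWord^[n] (u ++ v) = sigmaWord^[n] u ++ sigmaWord^[n] v := by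
  induction n with
  | zero => rfl
  | succ n ih => simp only [Function.iterate_succ_apply', ih, sigmaWord_append]

lemma iterate_nil (n : ℕ) : sigmaWord^[n] [] = [] :=
  Function.iterate_fixed sigmaWord_nil n

lemma iterate_eq_flatMap (n : ℕ) (w : List Letter) :
    sigmaWord^[n] w = w.flatMap fun c => sigmaWord^[n] [c] := by
  induction w with
  | nil => simp [iterate_nil]
  | cons c w ih => rw [List.flatMap_cons, ← ih, ← iterate_append]; rfl

lemma length_sigmaWord_le (w : List Letter) : (sigmaWord w).length ≤ 7 * w.length := by
  induction w with
  | nil => simp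
  | cons c w ih =>
    have : (sigma c).length ≤ 7 := by cases c <;> simp [sigma]
    simp only [sigmaWord_cons, List.length_append, List.length_cons]
    omega

lemma length_iterate_le (n : ℕ) (c : Letter) : (sigmaWord^[n] [c]).length ≤ 7 ^ n := by
  induction n with
  | zero => simp
  | succ n ih =>
    rw [Function.iterate_succ_apply', pow_succ]
    have := length_sigmaWord_le (sigmaWord^[n] [c])
    omega

/-! ### Desubstitution of legal words -/

lemma exists_eq_flatMap_append_of_prefix {A B : Type*} (τ : A → List B) {M : ℕ}
    (hτ : ∀ c, (τ c).length ≤ M) (u : List A) :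
    ∀ w : List B, w <+: u.flatMap τ →
      ∃ (v : List A) (p : List B), w = v.flatMap τ ++ p ∧ p.length ≤ M := by
  induction u with
  | nil =>
    intro w hw
    exact ⟨[], [], by simpa using hw, by simp⟩
  | cons c u ih =>
    intro w hw
    obtain ⟨t, ht⟩ := hw
    rw [List.flatMap_cons, List.append_eq_append_iff] at ht
    rcases ht with ⟨x, hx, -⟩ | ⟨w', rfl, hw'⟩
    · exact ⟨[], w, by simp, (List.IsPrefix.length_le ⟨x, hx.symm⟩).trans (hτ c)⟩
    · obtain ⟨v, p, rfl, hp⟩ := ih w' ⟨t, hw'.symm⟩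
      exact ⟨c :: v, p, by simp, hp⟩

/-- A factor of a concatenation of blocks cuts at most its first and its last block. If it lies
inside a single block, all of it goes into `s`. -/
lemma exists_eq_append_flatMap_append_of_infix {A B : Type*} (τ : A → List B) {M : ℕ}
    (hτ : ∀ c, (τ c).length ≤ M) (u : List A) :
    ∀ w : List B, w <:+: u.flatMap τ →
      ∃ (s : List B) (v : List A) (p : List B), w = s ++ v.flatMap τ ++ p ∧ s.length ≤ M ∧ p.length ≤ M := by
  induction u with
  | nil =>
    intro w hw
    exact ⟨[], [], [], by simpa using hw, by simp, by simp⟩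
  | cons c u ih =>
    intro w hw
    rw [List.flatMap_cons, List.infix_append_iff] at hw
    rcases hw with hw | hw | ⟨s, w', rfl, hs, hw'⟩
    · exact ⟨w, [], [], by simp, hw.length_le.trans (hτ c), by simp⟩
    · exact ih w hw
    · obtain ⟨v, p, rfl, hp⟩ := exists_eq_flatMap_append_of_prefix τ hτ u w' hw'
      exact ⟨s, v, p, by simp, hs.length_le.trans (hτ c), hp⟩

/-- A factor of `σᵐ(c)` with `m ≥ n` sits in a concatenation of level-`n` supertiles, each of at
most `7ⁿ` letters. For `m ≤ n` the whole word is short enough to serve as the end `s`. -/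
lemma IsLegal.exists_eq_append {w : List Letter} (hw : IsLegal w) (n : ℕ) :
    ∃ s v p, w = s ++ sigmaWord^[n] v ++ p ∧ s.length ≤ 7 ^ n ∧ p.length ≤ 7 ^ n := by
  obtain ⟨c, m, h⟩ := hw
  rcases le_total n m with hnm | hnm
  · obtain ⟨k, rfl⟩ := Nat.exists_eq_add_of_le hnm
    rw [Function.iterate_add_apply, iterate_eq_flatMap] at h
    obtain ⟨s, v, p, hw, hs, hp⟩ := exists_eq_append_flatMap_append_of_infix _
      (length_iterate_le n) _ _ h
    exact ⟨s, v, p, by rw [iterate_eq_flatMap]; exact hw, hs, hp⟩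
  · refine ⟨w, [], [], by simp [iterate_nil], ?_, by simp⟩
    exact h.length_le.trans ((length_iterate_le m c).trans (Nat.pow_le_pow_right (by norm_num) hnm))

/-! ### Densities of almost additive functions on words -/

/-- A real function on words which is additive under concatenation up to an error `C`. -/
structure AlmostAdditive (F : List Letter → ℝ) (C : ℝ) : Prop where
  nil : F [] = 0
  append : ∀ u v, |F (u ++ v) - F u - F v| ≤ C

namespace AlmostAdditive

variable {F : List Letter → ℝ} {C : ℝ}

lemma nonneg (hF : AlmostAdditive F C) : 0 ≤ C := le_trans (abs_nonneg _) (hF.append [] [])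

lemma abs_flatMap_sub_le (hF : AlmostAdditive F C) (τ : Letter → List Letter) (v : List Letter) :
    |F (v.flatMap τ) - (v.map fun c => F (τ c)).sum| ≤ C * v.length := by
  induction v with
  | nil => simp [hF.nil]
  | cons c v ih =>
    have := hF.append (τ c) (v.flatMap τ)
    simp only [List.flatMap_cons, List.map_cons, List.sum_cons, List.length_cons, Nat.cast_add,
      Nat.cast_one]
    rw [abs_le] at *
    constructor <;> linarith

lemma abs_flatMap_le (hF : AlmostAdditive F C) {τ : Letter → List Letter} {D : ℝ}
    (hD : ∀ c, |F (τ c)| ≤ D) (v : List Letter) : |F (v.flatMap τ)| ≤ (C + D) * v.length := by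
  induction v with
  | nil => simp [hF.nil]
  | cons c v ih =>
    have := hF.append (τ c) (v.flatMap τ)
    have := hD c
    simp only [List.flatMap_cons, List.length_cons, Nat.cast_add, Nat.cast_one]
    rw [abs_le] at *
    constructor <;> linarith

lemma abs_le (hF : AlmostAdditive F C) {D : ℝ} (hD : ∀ c, |F [c]| ≤ D) (v : List Letter) :
    |F v| ≤ (C + D) * v.length := by
  simpa using hF.abs_flatMap_le (τ := fun c => [c]) hD v

/-- Since `wordLength` is exactly additive, this reduces the density statement to density zero. -/
lemma sub_const_mul_wordLength (hF : AlmostAdditive F C) (κ : ℝ) :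
    AlmostAdditive (fun w => F w - κ * wordLength w) C where
  nil := by simp [hF.nil]
  append u v := by
    convert hF.append u v using 2
    rw [wordLength_append]
    ring

/-- Cut `σⁿ⁺¹(a) = σⁿ(aaaaabb)` into seven level-`n` supertiles, at a cost of `C` each. The analogue
for `b` needs only `3 * C` and is weakened to the same bound. -/
lemma abs_iterate_succ_a (hF : AlmostAdditive F C) (n : ℕ) :
    |F (sigmaWord^[n + 1] [.a]) - (5 * F (sigmaWord^[n] [.a]) + 2 * F (sigmaWord^[n] [.b]))|
      ≤ 7 * C := by
  have h := hF.abs_flatMap_sub_le (fun c => sigmaWord^[n] [c]) (sigma .a)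
  rw [← iterate_eq_flatMap] at h
  rw [Function.iterate_succ_apply, show sigmaWord [.a] = sigma .a from by simp [sigmaWord]]
  convert h using 1
  · congr 2
    simp [sigma]
    ring
  · simp [sigma]
    ring

lemma abs_iterate_succ_b (hF : AlmostAdditive F C) (n : ℕ) :
    |F (sigmaWord^[n + 1] [.b]) - (2 * F (sigmaWord^[n] [.a]) + F (sigmaWord^[n] [.b]))|
      ≤ 7 * C := by
  have h := hF.abs_flatMap_sub_le (fun c => sigmaWord^[n] [c]) (sigma .b)
  rw [← iterate_eq_flatMap] at h
  rw [Function.iterate_succ_apply, show sigmaWord [.b] = sigma .b from by simp [sigmaWord]]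
  refine le_trans (le_of_eq ?_) (h.trans ?_)
  · congr 2
    simp [sigma]
    ring
  · simp [sigma]
    linarith [hF.nonneg]

/-- The component of the values on supertiles along the contracting eigenvector is bounded. -/
lemma exists_abs_contracting_le (hF : AlmostAdditive F C) :
    ∃ K, ∀ n, |F (sigmaWord^[n] [.a]) - lam * F (sigmaWord^[n] [.b])| ≤ K := by
  have hl := two_lt_lam
  have hC := hF.nonneg
  set x := fun n => F (sigmaWord^[n] [.a])
  set y := fun n => F (sigmaWord^[n] [.b])
  set D := 7 * C * (1 + lam)
  have hD : 0 ≤ D := by positivity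
  -- One step multiplies by a factor of at most `1/2` and adds an error of at most `D`, so a bound
  -- of the form `c + 2 * D` with `c ≥ 0` is preserved.
  refine ⟨|x 0 - lam * y 0| + 2 * D, fun n => ?_⟩
  change |x n - lam * y n| ≤ _
  induction n with
  | zero => linarith
  | succ n ih =>
    have ha := hF.abs_iterate_succ_a n
    have hb := hF.abs_iterate_succ_b n
    change |x (n + 1) - (5 * x n + 2 * y n)| ≤ _ at ha
    change |y (n + 1) - (2 * x n + y n)| ≤ _ at hb
    -- `(1, -λ)` is the left eigenvector of the matrix for the eigenvalue `5 - 2λ`; the bounds on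
    -- `lam` below place this eigenvalue in `(0, 1/2)`.
    have key : x (n + 1) - lam * y (n + 1) = (5 - 2 * lam) * (x n - lam * y n)
        + (x (n + 1) - (5 * x n + 2 * y n)) - lam * (y (n + 1) - (2 * x n + y n)) := by
      linear_combination (-2 * y n) * lam_sq
    have hlt : lam < 5 / 2 := by nlinarith [lam_sq]
    have h9 : 9 / 4 < lam := by nlinarith [lam_sq]
    have hc : |(5 - 2 * lam) * (x n - lam * y n)| ≤ 1 / 2 * (|x 0 - lam * y 0| + 2 * D) := by
      rw [abs_mul, abs_of_pos (by linarith)]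
      exact mul_le_mul (by linarith) ih (abs_nonneg _) (by norm_num)
    have hd : |lam * (y (n + 1) - (2 * x n + y n))| ≤ lam * (7 * C) := by
      rw [abs_mul, abs_of_pos lam_pos]
      gcongr
    have h0 := abs_nonneg (x 0 - lam * y 0)
    rw [key]
    refine (abs_sub _ _).trans ?_
    refine (add_le_add (abs_add_le _ _) le_rfl).trans ?_
    have : D = 7 * C + lam * (7 * C) := by simp only [D]; ring
    linarith

/-- The normalised values on supertiles converge, with limits proportional to the tile lengths. -/
lemma exists_tendsto_iterate (hF : AlmostAdditive F C) :
    ∃ κ, ∀ c, Tendsto (fun n => F (sigmaWord^[n] [c]) / (lam ^ 2) ^ n) atTop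
      (𝓝 (κ * tileLength c)) := by
  have hl := two_lt_lam
  have hlp := lam_pos
  have hC := hF.nonneg
  set x := fun n => F (sigmaWord^[n] [.a]) with hx
  set y := fun n => F (sigmaWord^[n] [.b]) with hy
  have hq1 : (lam ^ 2)⁻¹ < 1 := inv_lt_one_of_one_lt₀ (by nlinarith)
  have hqt : Tendsto (fun n : ℕ => ((lam ^ 2) ^ n)⁻¹) atTop (𝓝 0) := by
    simpa only [inv_pow] using tendsto_pow_atTop_nhds_zero_of_lt_one (by positivity) hq1
  obtain ⟨K, hK⟩ := hF.exists_abs_contracting_le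
  have hB : Tendsto (fun n => (x n - lam * y n) / (lam ^ 2) ^ n) atTop (𝓝 0) := by
    refine squeeze_zero_norm (a := fun n : ℕ => K * ((lam ^ 2) ^ n)⁻¹) (fun n => ?_)
      (by simpa using hqt.const_mul K)
    rw [Real.norm_eq_abs, abs_div, abs_of_pos (a := (lam ^ 2) ^ n) (by positivity), div_eq_mul_inv]
    exact mul_le_mul_of_nonneg_right (hK n) (by positivity)
  -- The expanding component, from the left eigenvector `(λ, 1)`. Its increments come from the
  -- recursion errors alone, hence decay geometrically.
  set A := fun n => (lam * x n + y n) / (lam ^ 2) ^ n with hA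
  have hAc : CauchySeq A := by
    refine cauchySeq_of_le_geometric (lam ^ 2)⁻¹ (7 * C * (1 + lam)) hq1 fun n => ?_
    have ha := hF.abs_iterate_succ_a n
    have hb := hF.abs_iterate_succ_b n
    change |x (n + 1) - (5 * x n + 2 * y n)| ≤ _ at ha
    change |y (n + 1) - (2 * x n + y n)| ≤ _ at hb
    have key : A (n + 1) - A n = (lam * (x (n + 1) - (5 * x n + 2 * y n))
        + (y (n + 1) - (2 * x n + y n))) / (lam ^ 2) ^ (n + 1) := by
      simp only [hA]
      rw [pow_succ (lam ^ 2) n]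
      field_simp
      linear_combination (-(lam * x n + y n) - 2 * x n) * lam_sq
    rw [dist_comm, Real.dist_eq, key, abs_div,
      abs_of_pos (a := (lam ^ 2) ^ (n + 1)) (by positivity), inv_pow, ← div_eq_mul_inv]
    have hnum : |lam * (x (n + 1) - (5 * x n + 2 * y n)) + (y (n + 1) - (2 * x n + y n))|
        ≤ 7 * C * (1 + lam) := by
      refine (abs_add_le _ _).trans ?_
      rw [abs_mul, abs_of_pos hlp]
      nlinarith
    refine div_le_div₀ (by positivity) hnum (by positivity) ?_
    exact pow_le_pow_right₀ (by nlinarith) (Nat.le_succ n)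
  obtain ⟨A', hA'⟩ := cauchySeq_tendsto_of_complete hAc
  -- Solve `A = λx + y`, `B = x - λy` for `x = (λA + B)/(λ² + 1)` and `y = (A - λB)/(λ² + 1)`, where
  -- `B → 0` after normalisation.
  refine ⟨A' / (lam ^ 2 + 1), fun c => ?_⟩
  cases c
  · have h := ((hA'.const_mul lam).add hB).div_const (lam ^ 2 + 1)
    convert h using 1
    · funext n
      change x n / _ = _
      simp only [hA]
      field_simp
      ring
    · simp only [tileLength]
      congr 1
      ring
  · have h := (hA'.sub (hB.const_mul lam)).div_const (lam ^ 2 + 1)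
    convert h using 1
    · funext n
      change y n / _ = _
      simp only [hA]
      field_simp
      ring
    · simp [tileLength]

/-- An almost additive function has a uniform density on long legal words. -/
theorem exists_density (hF : AlmostAdditive F C) :
    ∃ κ, (∀ c, Tendsto (fun n => F (sigmaWord^[n] [c]) / (lam ^ 2) ^ n) atTop
        (𝓝 (κ * tileLength c))) ∧
      ∀ ε > 0, ∃ K, ∀ w, IsLegal w → K ≤ wordLength w →
        |F w - κ * wordLength w| ≤ ε * wordLength w := by
  obtain ⟨κ, hκ⟩ := hF.exists_tendsto_iterate
  refine ⟨κ, hκ, fun ε hε => ?_⟩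
  have hC := hF.nonneg
  have hl := two_lt_lam
  have hG := hF.sub_const_mul_wordLength κ
  set G := fun w => F w - κ * wordLength w with hGdef
  have hq1 : (lam ^ 2)⁻¹ < 1 := inv_lt_one_of_one_lt₀ (by nlinarith)
  have hqt : Tendsto (fun n : ℕ => C * ((lam ^ 2) ^ n)⁻¹) atTop (𝓝 0) := by
    simpa only [inv_pow, mul_zero] using
      (tendsto_pow_atTop_nhds_zero_of_lt_one (by positivity) hq1).const_mul C
  have hGt : ∀ c, Tendsto (fun n => G (sigmaWord^[n] [c]) / (lam ^ 2) ^ n) atTop (𝓝 0) := by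
    intro c
    have h := (hκ c).sub_const (κ * tileLength c)
    rw [sub_self] at h
    refine h.congr fun n => ?_
    have := lam_pos
    simp only [hGdef, wordLength_iterate, wordLength_cons, wordLength_nil, add_zero]
    field_simp
  have hev : ∀ c, ∀ᶠ n in atTop, |G (sigmaWord^[n] [c])| ≤ ε / 4 * (lam ^ 2) ^ n := by
    intro c
    filter_upwards [(hGt c).eventually (Metric.closedBall_mem_nhds 0 (by positivity : 0 < ε / 4))]
      with n hn
    rw [dist_zero_right, Real.norm_eq_abs, abs_div,
      abs_of_pos (a := (lam ^ 2) ^ n) (by have := lam_pos; positivity)] at hn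
    rwa [div_le_iff₀ (by have := lam_pos; positivity)] at hn
  have hev2 : ∀ᶠ n : ℕ in atTop, C ≤ ε / 4 * (lam ^ 2) ^ n := by
    filter_upwards [hqt.eventually (Iic_mem_nhds (by positivity : 0 < ε / 4))] with n hn
    have hp : 0 < (lam ^ 2) ^ n := by have := lam_pos; positivity
    rw [← div_eq_mul_inv, div_le_iff₀ hp] at hn
    exact hn
  -- Fix a level at which both the value of `G` on a supertile and the cost `C` of a seam are small
  -- against `λ²ⁿ`; the length threshold is chosen afterwards.
  obtain ⟨n, ha, hb, hn⟩ := ((hev .a).and ((hev .b).and hev2)).exists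
  set D := max |G [.a]| |G [.b]|
  have hD : ∀ c, |G [c]| ≤ D := by
    intro c
    cases c
    exacts [le_max_left _ _, le_max_right _ _]
  have hD0 : 0 ≤ D := (abs_nonneg _).trans (hD .a)
  -- Two seams and two end pieces of at most `7ⁿ` letters; the threshold makes `E` at most half of
  -- the allowed error.
  set E := 2 * C + 2 * ((C + D) * 7 ^ n)
  refine ⟨E / (ε / 2), fun w hw hK => ?_⟩
  rw [div_le_iff₀ (by positivity)] at hK
  obtain ⟨s, v, p, rfl, hs, hp⟩ := hw.exists_eq_append n
  have hbd : ∀ u : List Letter, u.length ≤ 7 ^ n → |G u| ≤ (C + D) * 7 ^ n := by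
    intro u hu
    refine (hG.abs_le hD u).trans (mul_le_mul_of_nonneg_left ?_ (by positivity))
    exact_mod_cast hu
  have h1 := hG.append (s ++ sigmaWord^[n] v) p
  have h2 := hG.append s (sigmaWord^[n] v)
  have h3 := hbd s hs
  have h4 := hbd p hp
  have h5 : |G (sigmaWord^[n] v)| ≤ ε / 2 * wordLength (sigmaWord^[n] v) := by
    rw [wordLength_iterate, iterate_eq_flatMap]
    refine (hG.abs_flatMap_le (D := ε / 4 * (lam ^ 2) ^ n) ?_ v).trans ?_
    · intro c
      cases c
      exacts [ha, hb]
    · have hp : 0 < (lam ^ 2) ^ n := by have := lam_pos; positivity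
      calc (C + ε / 4 * (lam ^ 2) ^ n) * v.length
          ≤ (ε / 4 * (lam ^ 2) ^ n + ε / 4 * (lam ^ 2) ^ n) * wordLength v := by
            refine mul_le_mul (by linarith) (length_le_wordLength v) (by positivity) (by positivity)
        _ = _ := by ring
  have h6 : wordLength (sigmaWord^[n] v) ≤ wordLength (s ++ sigmaWord^[n] v ++ p) := by
    simp only [wordLength_append]
    linarith [wordLength_nonneg s, wordLength_nonneg p]
  have h7 := mul_le_mul_of_nonneg_left h6 (by positivity : 0 ≤ ε / 2)
  change |G (s ++ sigmaWord^[n] v ++ p)| ≤ _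
  simp only [E] at hK
  rw [_root_.abs_le] at *
  constructor <;> linarith

end AlmostAdditive

lemma almostAdditive_length : AlmostAdditive (fun w => (w.length : ℝ)) 0 where
  nil := by simp
  append u v := by simp

/-! ### Sums over the points of a word, and pair counts -/

/-- The sum of `f` over the left endpoints of the tiles of type `α` in the patch of tiles
that spells the given word and starts at `0`. -/
noncomputable def pointSum (α : Letter) : List Letter → (ℝ → ℝ) → ℝ
  | [], _ => 0
  | c :: w, f => (if c = α then f 0 else 0) + pointSum α w fun p => f (tileLength c + p)

lemma pointSum_append (α : Letter) (u v : List Letter) (f : ℝ → ℝ) :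
    pointSum α (u ++ v) f = pointSum α u f + pointSum α v fun p => f (wordLength u + p) := by
  induction u generalizing f with
  | nil => simp [pointSum]
  | cons c u ih => simp only [List.cons_append, pointSum, ih, wordLength_cons, add_assoc]

lemma pointSum_zero (α : Letter) (w : List Letter) : pointSum α w (fun _ => 0) = 0 := by
  induction w with
  | nil => rfl
  | cons c w ih => simp [pointSum, ih]

lemma pointSum_add (α : Letter) (w : List Letter) (f g : ℝ → ℝ) :
    pointSum α w (fun p => f p + g p) = pointSum α w f + pointSum α w g := by
  induction w generalizing f g with
  | nil => simp [pointSum]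
  | cons c w ih =>
    simp only [pointSum, ih]
    split_ifs <;> ring

lemma pointSum_list_sum {ι : Type*} (α : Letter) (w : List Letter) (l : List ι) (g : ι → ℝ → ℝ) :
    pointSum α w (fun p => (l.map fun i => g i p).sum)
      = (l.map fun i => pointSum α w (g i)).sum := by
  induction l with
  | nil => simp [pointSum_zero]
  | cons i l ih => simp only [List.map_cons, List.sum_cons, pointSum_add, ih]

lemma pointSum_comm (α β : Letter) (u v : List Letter) (g : ℝ → ℝ → ℝ) :
    pointSum α u (fun p => pointSum β v fun q => g p q)
      = pointSum β v fun q => pointSum α u fun p => g p q := by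
  induction u generalizing g with
  | nil => simp [pointSum, pointSum_zero]
  | cons c u ih =>
    simp only [pointSum]
    rw [pointSum_add, ih fun p q => g (tileLength c + p) q]
    congr 1
    split_ifs
    · rfl
    · rw [pointSum_zero]

lemma pointSum_nonneg (α : Letter) (w : List Letter) {f : ℝ → ℝ} (hf : ∀ p, 0 ≤ f p) :
    0 ≤ pointSum α w f := by
  induction w generalizing f with
  | nil => exact le_rfl
  | cons c w ih =>
    have := ih fun p => hf (tileLength c + p)
    have := hf 0
    simp only [pointSum]
    split_ifs <;> linarith

lemma pointSum_le_length (α : Letter) (w : List Letter) {f : ℝ → ℝ} (hf0 : ∀ p, 0 ≤ f p)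
    (hf : ∀ p, f p ≤ 1) : pointSum α w f ≤ w.length := by
  induction w generalizing f with
  | nil => simp [pointSum]
  | cons c w ih =>
    have := ih (fun p => hf0 (tileLength c + p)) fun p => hf (tileLength c + p)
    have := hf 0
    simp only [pointSum, List.length_cons, Nat.cast_add, Nat.cast_one]
    split_ifs <;> linarith

lemma pointSum_indicator_of_neg (α : Letter) (w : List Letter) {t : ℝ} (ht : t < 0) :
    pointSum α w (fun q => if q = t then 1 else 0) = 0 := by
  induction w generalizing t with
  | nil => rfl
  | cons c w ih =>
    have := one_le_tileLength c
    simp only [pointSum, ← eq_sub_iff_add_eq', ht.ne', if_false, ite_self, zero_add]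
    exact ih (by linarith)

/-- Tile lengths are positive, so at most one tile starts at `t`. -/
lemma pointSum_indicator_le_one (α : Letter) (w : List Letter) (t : ℝ) :
    pointSum α w (fun q => if q = t then 1 else 0) ≤ 1 := by
  induction w generalizing t with
  | nil => simp [pointSum]
  | cons c w ih =>
    have h := one_le_tileLength c
    simp only [pointSum, ← eq_sub_iff_add_eq']
    rcases eq_or_ne 0 t with rfl | ht
    · rw [pointSum_indicator_of_neg _ _ (by linarith)]
      split_ifs <;> norm_num
    · simpa [ht] using ih (t - tileLength c)

/-- Only tiles starting in the last stretch of length `z` contribute. They form a suffix of `u`,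
whose number of tiles is at most its length because every tile has length at least `1`. -/
lemma pointSum_le_of_eq_zero (α : Letter) (u : List Letter) {z : ℝ} {h : ℝ → ℝ}
    (h0 : ∀ p, 0 ≤ h p) (h1 : ∀ p, h p ≤ 1) (hz : ∀ p, p + z < wordLength u → h p = 0) :
    pointSum α u h ≤ |z| := by
  induction u generalizing h with
  | nil => simp [pointSum]
  | cons c u ih =>
    rcases lt_or_ge z (wordLength (c :: u)) with hlt | hge
    · simp only [pointSum, hz 0 (by simpa using hlt), ite_self, zero_add]
      refine ih (fun p => h0 _) (fun p => h1 _) fun p hp => hz _ ?_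
      rw [wordLength_cons]
      linarith
    · exact (pointSum_le_length α _ h0 h1).trans
        ((length_le_wordLength _).trans (hge.trans (le_abs_self z)))

/-- The number of pairs of tiles of types `α` and `β` at signed distance `z` in a word. -/
noncomputable def pairCount (α β : Letter) (z : ℝ) (w : List Letter) : ℝ :=
  pointSum α w fun p => pointSum β w fun q => if q = p + z then 1 else 0

lemma pairCount_comm (α β : Letter) (z : ℝ) (w : List Letter) :
    pairCount β α z w = pairCount α β (-z) w := by
  rw [pairCount, pointSum_comm, pairCount]
  simp only [← sub_eq_add_neg, eq_sub_iff_add_eq, eq_comm]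

/-- A pair from `u` to `v` straddles the seam, so its first point is within `z` of the end of `u`
and determines the second. -/
lemma crossCount_mem (α β : Letter) (z : ℝ) (u v : List Letter) :
    0 ≤ pointSum α u (fun p => pointSum β v fun q => if wordLength u + q = p + z then 1 else 0) ∧
    pointSum α u (fun p => pointSum β v fun q => if wordLength u + q = p + z then 1 else 0)
      ≤ |z| := by
  simp only [← eq_sub_iff_add_eq']
  have hn : ∀ p, 0 ≤ pointSum β v fun q => if q = p + z - wordLength u then 1 else 0 := fun p =>
    pointSum_nonneg β v fun q => by split_ifs <;> norm_num
  refine ⟨pointSum_nonneg α u hn, pointSum_le_of_eq_zero α u hn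
    (fun p => pointSum_indicator_le_one β v _) fun p hp => ?_⟩
  exact pointSum_indicator_of_neg β v (by linarith)

lemma almostAdditive_pairCount (α β : Letter) (z : ℝ) :
    AlmostAdditive (pairCount α β z) (2 * |z|) where
  nil := rfl
  append u v := by
    have h1 := crossCount_mem α β z u v
    have h2 := crossCount_mem β α (-z) u v
    -- Pairs from `v` back to `u` at distance `z` are pairs from `u` to `v` at distance `-z`.
    rw [pointSum_comm, abs_neg] at h2
    simp only [← sub_eq_add_neg, eq_sub_iff_add_eq] at h2
    have key : pairCount α β z (u ++ v) = pairCount α β z u + pairCount α β z v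
        + pointSum α u (fun p => pointSum β v fun q => if wordLength u + q = p + z then 1 else 0)
        + pointSum α v (fun p => pointSum β u fun q =>
            if wordLength u + p + z = q then 1 else 0) := by
      simp only [pairCount, pointSum_append, pointSum_add, add_assoc, add_right_inj]
      simp only [eq_comm]
      ring
    rw [key, abs_le]
    constructor <;> linarith [h1.1, h1.2, h2.1, h2.2]

/-! ### Renormalisation of pair counts -/

/-- The occurrences of the letter `α` in the images `sigma c`: pairs of `c` and the offset
of the occurrence inside the patch of `sigma c`. -/
noncomputable def occurrences : Letter → List (Letter × ℝ)
  | .a => [(.a, 0), (.a, lam), (.a, 2 * lam), (.a, 3 * lam), (.a, 4 * lam), (.b, 1), (.b, 1 + lam)]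
  | .b => [(.a, 5 * lam), (.a, 5 * lam + 1), (.b, 0)]

/-- Substitution inflates lengths by `λ²`, so the image of a tile at `p` starts at `λ² p`. -/
lemma pointSum_sigmaWord (α : Letter) (w : List Letter) (f : ℝ → ℝ) :
    pointSum α (sigmaWord w) f
      = ((occurrences α).map fun e => pointSum e.1 w fun p => f (lam ^ 2 * p + e.2)).sum := by
  induction w generalizing f with
  | nil => simp [pointSum]
  | cons c w ih =>
    have hc : pointSum α (sigma c) f = ((occurrences α).map fun e =>
        if c = e.1 then f (lam ^ 2 * 0 + e.2) else 0).sum := by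
      cases c <;> cases α <;>
        simp [sigma, occurrences, pointSum, tileLength] <;> ring_nf
    rw [sigmaWord_cons, pointSum_append, wordLength_sigma, ih, hc]
    simp only [pointSum, List.sum_map_add, mul_add, add_assoc]

lemma pairCount_sigmaWord (α β : Letter) (z : ℝ) (w : List Letter) :
    pairCount α β z (sigmaWord w) = ((occurrences α).map fun e => ((occurrences β).map fun e' =>
      pairCount e.1 e'.1 ((z + e.2 - e'.2) / lam ^ 2) w).sum).sum := by
  have hl : lam ^ 2 ≠ 0 := pow_ne_zero _ lam_pos.ne'
  have h : ∀ p q s t : ℝ,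
      (lam ^ 2 * q + t = lam ^ 2 * p + s + z) ↔ q = p + (z + s - t) / lam ^ 2 := by
    intro p q s t
    rw [← sub_eq_iff_eq_add' (a := q), eq_div_iff hl]
    constructor <;> intro h <;> linarith
  rw [pairCount, pointSum_sigmaWord]
  simp only [pointSum_sigmaWord β, h, pointSum_list_sum, pairCount]

/-- The densities of the pair counts satisfy the renormalisation equations. -/
lemma density_renormalisation {κ : Letter → Letter → ℝ → ℝ}
    (hκ : ∀ α β z, Tendsto (fun n => pairCount α β z (sigmaWord^[n] [.b]) / (lam ^ 2) ^ n) atTop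
      (𝓝 (κ α β z))) (α β : Letter) (z : ℝ) :
    lam ^ 2 * κ α β z = ((occurrences α).map fun e => ((occurrences β).map fun e' =>
      κ e.1 e'.1 ((z + e.2 - e'.2) / lam ^ 2)).sum).sum := by
  have h1 := (((tendsto_add_atTop_iff_nat 1).2 (hκ α β z)).const_mul (lam ^ 2))
  refine tendsto_nhds_unique h1 ?_
  have h2 := tendsto_list_sum (occurrences α) fun e _ => tendsto_list_sum (occurrences β)
    fun e' _ => hκ e.1 e'.1 ((z + e.2 - e'.2) / lam ^ 2)
  refine h2.congr fun n => ?_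
  have hl : lam ≠ 0 := lam_pos.ne'
  rw [Function.iterate_succ_apply', pairCount_sigmaWord, pow_succ (lam ^ 2) n]
  simp only [div_eq_mul_inv _ ((lam ^ 2) ^ n), List.sum_map_mul_right]
  field_simp

/-! ### The substitution matrix -/

lemma vecMul_tileLength : Matrix.vecMul tileLength sigmaMatrix = lam ^ 2 • tileLength := by
  have hu : (Finset.univ : Finset Letter) = {.a, .b} := rfl
  funext c
  cases c
  · simp [Matrix.vecMul, dotProduct, hu, sigmaMatrix, sigma, tileLength]
    linear_combination (-lam - 2) * lam_sq
  · simp [Matrix.vecMul, dotProduct, hu, sigmaMatrix, sigma, tileLength]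
    linear_combination (-1) * lam_sq

/-- The characteristic polynomial is `μ² - 6μ + 1 = (μ - λ²)(μ - (5 - 2λ))`. -/
lemma norm_lt_of_hasEigenvalue {μ : ℂ}
    (h : Module.End.HasEigenvalue
      (Matrix.toLin' (sigmaMatrix.map (fun x : ℝ => (x : ℂ)))) μ)
    (hμ : μ ≠ ((lam ^ 2 : ℝ) : ℂ)) : ‖μ‖ < lam ^ 2 := by
  have hu : (Finset.univ : Finset Letter) = {.a, .b} := rfl
  obtain ⟨v, hv⟩ := h.exists_hasEigenvector
  have hv0 := hv.2
  have he := hv.apply_eq_smul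
  have ha := congrFun he .a
  have hb := congrFun he .b
  simp [Matrix.mulVec, dotProduct, hu, sigmaMatrix, sigma] at ha hb
  have hva : v .a ≠ 0 := by
    intro h0
    refine hv0 (funext fun c => ?_)
    rw [h0] at ha
    cases c
    · exact h0
    · simpa using ha
  have hchar : (μ ^ 2 - 6 * μ + 1) * v .a = 0 := by
    linear_combination (1 - μ) * ha - 2 * hb
  have hchar' : μ ^ 2 - 6 * μ + 1 = 0 := (mul_eq_zero.1 hchar).resolve_right hva
  have hlc : (lam : ℂ) ^ 2 = 2 * lam + 1 := by exact_mod_cast lam_sq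
  have hfac : (μ - ((lam ^ 2 : ℝ) : ℂ)) * (μ - ((5 - 2 * lam : ℝ) : ℂ)) = 0 := by
    push_cast
    linear_combination hchar' + (5 - 2 * lam - μ - 4) * hlc
  have hμ' : μ = ((5 - 2 * lam : ℝ) : ℂ) :=
    sub_eq_zero.1 ((mul_eq_zero.1 hfac).resolve_left (sub_ne_zero.2 hμ))
  rw [hμ', Complex.norm_real, Real.norm_eq_abs, abs_lt]
  have := two_lt_lam
  have := lam_sq
  constructor <;> nlinarith

/-! ### Existence of a tiling -/

/-- The position of the origin in the supertile of level `n`, under the nested embedding of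
the supertiles as the second tile of the next supertile. -/
def originIndex : ℕ → ℕ
  | 0 => 0
  | n + 1 => originIndex n + (sigmaWord^[n] [.a]).length

lemma length_le_length_iterate (n : ℕ) (w : List Letter) :
    w.length ≤ (sigmaWord^[n] w).length := by
  induction n with
  | zero => simp
  | succ n ih =>
    rw [Function.iterate_succ_apply']
    refine ih.trans ?_
    generalize sigmaWord^[n] w = u
    induction u with
    | nil => simp
    | cons c u ih =>
      have : 1 ≤ (sigma c).length := by cases c <;> simp [sigma]
      simp only [sigmaWord_cons, List.length_append, List.length_cons]
      omega

/-- The second `a` of `σ(a)` has neighbours on both sides, so supertiles nested at that place grow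
in both directions and exhaust `ℤ`. -/
lemma iterate_succ_a (n : ℕ) : sigmaWord^[n + 1] [.a] =
    sigmaWord^[n] [.a] ++ (sigmaWord^[n] [.a] ++ sigmaWord^[n] [.a, .a, .a, .b, .b]) := by
  simp only [← iterate_append, Function.iterate_succ_apply]
  rfl

lemma le_originIndex (n : ℕ) : n ≤ originIndex n := by
  induction n with
  | zero => simp
  | succ n ih =>
    have := length_le_length_iterate n [.a]
    simp only [originIndex, List.length_singleton] at *
    omega

lemma originIndex_add_lt (n : ℕ) : originIndex n + n < (sigmaWord^[n] [.a]).length := by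
  induction n with
  | zero => simp [originIndex]
  | succ n ih =>
    have := length_le_length_iterate n [.a, .a, .a, .b, .b]
    simp only [originIndex, iterate_succ_a, List.length_append, List.length_cons] at *
    omega

/-- A bi-infinite word all of whose finite subwords are legal. -/
def bilateralWord (k : ℤ) : Letter :=
  -- The level-`n` supertile reaches at least `n` letters to either side of the origin, so neither
  -- `toNat` nor the default value takes effect.
  (sigmaWord^[k.natAbs] [.a]).getD (k + originIndex k.natAbs).toNat .a

lemma getD_originIndex {k : ℤ} {n m : ℕ} (hn : k.natAbs ≤ n) (hm : n ≤ m) :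
    (sigmaWord^[m] [.a]).getD (k + originIndex m).toNat .a
      = (sigmaWord^[n] [.a]).getD (k + originIndex n).toNat .a := by
  induction m, hm using Nat.le_induction with
  | base => rfl
  | succ m hm ih =>
    have h1 := le_originIndex m
    have h2 := originIndex_add_lt m
    rw [← ih, iterate_succ_a, List.getD_append_right _ _ _ _ (by rw [originIndex]; omega),
      List.getD_append _ _ _ _ (by rw [originIndex]; omega)]
    congr 1
    rw [originIndex]
    omega

lemma isLegal_bilateralWord (n : ℤ) (k : ℕ) :
    IsLegal ((List.range k).map fun i : ℕ => bilateralWord (n + i)) := by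
  set N := n.natAbs + k
  have h1 := le_originIndex N
  have h2 := originIndex_add_lt N
  refine ⟨.a, N, ?_⟩
  have : ((List.range k).map fun i : ℕ => bilateralWord (n + i))
      = ((sigmaWord^[N] [.a]).drop (n + originIndex N).toNat).take k := by
    refine List.ext_getElem (by simp; omega) fun i hi hi' => ?_
    have hik : i < k := by simpa using hi
    simp only [List.getElem_map, List.getElem_range, List.getElem_take, List.getElem_drop]
    rw [bilateralWord, ← getD_originIndex (m := N) le_rfl (by omega)]
    rw [List.getD_eq_getElem _ _ (by omega)]
    congr 1
    omega
  rw [this]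
  exact (List.take_prefix _ _).isInfix.trans (List.drop_suffix _ _).isInfix

/-- The left endpoints of consecutive tiles of the given types, starting at `0`. -/
noncomputable def tilePosition (x : ℤ → Letter) : ℤ → ℝ
  | (n : ℕ) => ∑ i ∈ Finset.range n, tileLength (x i)
  | .negSucc n => -∑ i ∈ Finset.range (n + 1), tileLength (x (.negSucc i))

lemma tilePosition_succ (x : ℤ → Letter) (n : ℤ) :
    tilePosition x (n + 1) = tilePosition x n + tileLength (x n) := by
  cases n with
  | ofNat n => exact Finset.sum_range_succ _ n
  | negSucc n =>
    cases n with
    | zero =>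
      change (∑ i ∈ Finset.range 0, tileLength (x i)) = _
      simp [tilePosition]
    | succ n =>
      change tilePosition x (.negSucc n) = _
      simp only [tilePosition]
      rw [Finset.sum_range_succ _ (n + 1)]
      ring

lemma nonempty_sigmaTiling : Nonempty SigmaTiling :=
  ⟨{ letter := bilateralWord
     pos := tilePosition bilateralWord
     pos_succ := tilePosition_succ _
     legal := isLegal_bilateralWord }⟩

/-! ### Patches of a tiling -/

namespace SigmaTiling

variable (T : SigmaTiling)

/-- The word of the `k` consecutive tiles of the tiling that start with the tile `m`. -/
def word (m : ℤ) (k : ℕ) : List Letter := (List.range k).map fun i : ℕ => T.letter (m + i)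

@[simp] lemma length_word (m : ℤ) (k : ℕ) : (T.word m k).length = k := by simp [word]

lemma word_succ (m : ℤ) (k : ℕ) : T.word m (k + 1) = T.word m k ++ [T.letter (m + k)] := by
  simp [word, List.range_succ]

lemma wordLength_word (m : ℤ) (k : ℕ) : wordLength (T.word m k) = T.pos (m + k) - T.pos m := by
  induction k with
  | zero => simp [word]
  | succ k ih =>
    rw [word_succ, wordLength_append, ih, Nat.cast_succ, ← add_assoc, T.pos_succ]
    simp only [wordLength_cons, wordLength_nil]
    ring

lemma sub_le_pos_sub {m n : ℤ} (h : m ≤ n) : (n - m : ℝ) ≤ T.pos n - T.pos m := by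
  obtain ⟨k, rfl⟩ := Int.le.dest h
  have := length_le_wordLength (T.word m k)
  rw [wordLength_word, length_word] at this
  push_cast
  linarith

lemma pos_strictMono : StrictMono T.pos := by
  intro m n h
  have h1 := T.sub_le_pos_sub h.le
  have h2 : (m : ℝ) < n := by exact_mod_cast h
  linarith

lemma pos_injective : Function.Injective T.pos := T.pos_strictMono.injective

/-- Left general in `s` to serve both ends of the open ball: the open half-line at `-r` and the
closed one at `r`. -/
lemma exists_first_pos_mem {r : ℝ} {s : Set ℝ} (h1 : Set.Ioi r ⊆ s) (h2 : s ⊆ Set.Ici r) :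
    ∃ m : ℤ, T.pos m ∈ s ∧ T.pos (m - 1) ∉ s := by
  obtain ⟨m, hm, hmin⟩ := Int.exists_least_of_bdd (P := fun n => T.pos n ∈ s) (by
      refine ⟨min 0 ⌊r - T.pos 0⌋, fun n hn => ?_⟩
      rcases le_total 0 n with h | h
      · exact (min_le_left _ _).trans h
      · refine (min_le_right _ _).trans ?_
        have hd := T.sub_le_pos_sub h
        have hf := Int.floor_le (r - T.pos 0)
        have hr : r ≤ T.pos n := h2 hn
        push_cast at hd
        have : (⌊r - T.pos 0⌋ : ℝ) ≤ n := by linarith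
        exact_mod_cast this) (by
      refine ⟨max 0 (⌊r - T.pos 0⌋ + 1), h1 ?_⟩
      have hd := T.sub_le_pos_sub (le_max_left 0 (⌊r - T.pos 0⌋ + 1))
      have hf := Int.lt_floor_add_one (r - T.pos 0)
      have hm : ((⌊r - T.pos 0⌋ + 1 : ℤ) : ℝ) ≤ (max 0 (⌊r - T.pos 0⌋ + 1) : ℤ) :=
        Int.cast_le.2 (le_max_right _ _)
      rw [Set.mem_Ioi]
      rw [Int.cast_add, Int.cast_one] at hm
      rw [Int.cast_zero] at hd
      linarith)
  refine ⟨m, hm, fun h => ?_⟩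
  have := hmin _ h
  omega

/-- The tiles with left endpoint in a ball around `0` form a finite patch. -/
lemma exists_patch (r : ℝ) : ∃ (m : ℤ) (k : ℕ),
    (∀ n, T.pos n ∈ Metric.ball 0 r ↔ m ≤ n ∧ n < m + k) ∧
      2 * r - lam ≤ wordLength (T.word m k) := by
  obtain ⟨m, hm, hm'⟩ := T.exists_first_pos_mem (s := Set.Ioi (-r)) subset_rfl Set.Ioi_subset_Ici_self
  obtain ⟨l, hl, hl'⟩ := T.exists_first_pos_mem (s := Set.Ici r) Set.Ioi_subset_Ici_self subset_rfl
  simp only [Set.mem_Ioi, Set.mem_Ici, not_lt, not_le] at hm hm' hl hl'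
  refine ⟨m, (l - m).toNat, fun n => ?_, ?_⟩
  · have e1 : m ≤ n ↔ -r < T.pos n := by
      refine ⟨fun h => hm.trans_le (T.pos_strictMono.monotone h), fun h => ?_⟩
      have := T.pos_strictMono.lt_iff_lt.1 (hm'.trans_lt h)
      omega
    have e2 : n < l ↔ T.pos n < r := by
      refine ⟨fun h => (T.pos_strictMono.monotone (by omega)).trans_lt hl', fun h => ?_⟩
      exact T.pos_strictMono.lt_iff_lt.1 (h.trans_le hl)
    rw [mem_ball_zero_iff, Real.norm_eq_abs, abs_lt, ← e1, ← e2]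
    omega
  -- The preceding left endpoint is at most `-r`, so the patch starts no later than `-r + λ`. Should
  -- `l < m` occur, `toNat` gives the empty patch and `h3` still holds.
  · have h1 := T.pos_succ (m - 1)
    rw [sub_add_cancel] at h1
    have h2 := tileLength_le (T.letter (m - 1))
    have h3 : T.pos l ≤ T.pos (m + (l - m).toNat) := T.pos_strictMono.monotone (by omega)
    rw [wordLength_word]
    linarith

lemma pointSum_word (α : Letter) (m : ℤ) (k : ℕ) (f : ℝ → ℝ) :
    pointSum α (T.word m k) f = ∑ i ∈ Finset.range k,
      if T.letter (m + i) = α then f (T.pos (m + i) - T.pos m) else 0 := by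
  induction k with
  | zero => simp [word, pointSum]
  | succ k ih =>
    rw [word_succ, pointSum_append, ih, wordLength_word, Finset.sum_range_succ]
    simp [pointSum]

open Classical in
lemma pairCount_word (α β : Letter) (z : ℝ) (m : ℤ) (k : ℕ) :
    pairCount α β z (T.word m k) = ((Finset.range k).filter fun i : ℕ =>
      T.letter (m + i) = α ∧ ∃ j < k, T.letter (m + j) = β ∧
        T.pos (m + j) = T.pos (m + i) + z).card := by
  rw [pairCount, pointSum_word, Finset.card_filter, Nat.cast_sum]
  refine Finset.sum_congr rfl fun i _ => ?_
  rw [pointSum_word]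
  by_cases hα : T.letter (m + i) = α
  · rw [if_pos hα]
    by_cases hj : ∃ j < k, T.letter (m + j) = β ∧ T.pos (m + j) = T.pos (m + i) + z
    · rw [if_pos ⟨hα, hj⟩]
      obtain ⟨j, hjk, hjβ, hjz⟩ := hj
      rw [Finset.sum_eq_single_of_mem j (Finset.mem_range.2 hjk), if_pos hjβ, if_pos (by linarith)]
      · simp
      · intro j' _ hne
        rw [if_neg (c := T.pos (m + j') - T.pos m = T.pos (m + i) - T.pos m + z), ite_self]
        intro h
        refine hne ?_
        have : T.pos (m + j') = T.pos (m + j) := by linarith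
        have := T.pos_injective this
        omega
    · rw [if_neg fun h => hj h.2, Nat.cast_zero]
      refine Finset.sum_eq_zero fun j hjk => ?_
      split_ifs with h1 h2
      · exact absurd ⟨j, Finset.mem_range.1 hjk, h1, by linarith⟩ hj
      · rfl
      · rfl
  · rw [if_neg hα, if_neg fun h => hα h.1, Nat.cast_zero]

lemma mem_points_pos (α : Letter) (n : ℤ) : T.pos n ∈ T.points α ↔ T.letter n = α := by
  constructor
  · rintro ⟨m, hm, h⟩
    rwa [← T.pos_injective h]
  · exact fun h => ⟨n, h, rfl⟩

variable {T} {m : ℤ} {k : ℕ} {r : ℝ}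

lemma ncard_allPoints_inter (h : ∀ n, T.pos n ∈ Metric.ball 0 r ↔ m ≤ n ∧ n < m + k) :
    (T.allPoints ∩ Metric.ball 0 r).ncard = k := by
  have : T.allPoints ∩ Metric.ball 0 r
      = (fun i : ℕ => T.pos (m + i)) '' (Finset.range k : Finset ℕ) := by
    ext x
    simp only [allPoints, Set.mem_inter_iff, Set.mem_iUnion, Set.mem_image, Finset.mem_coe,
      Finset.mem_range]
    constructor
    · rintro ⟨⟨α, n, -, rfl⟩, hx⟩
      rw [h] at hx
      exact ⟨(n - m).toNat, by omega, by congr 1; omega⟩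
    · rintro ⟨i, hi, rfl⟩
      exact ⟨⟨_, m + i, rfl, rfl⟩, (h _).2 (by omega)⟩
  rw [this, Set.ncard_image_of_injective, Set.ncard_coe_finset, Finset.card_range]
  intro i j hij
  have := T.pos_injective hij
  omega

open Classical in
lemma ncard_pairs (h : ∀ n, T.pos n ∈ Metric.ball 0 r ↔ m ≤ n ∧ n < m + k) (α β : Letter) (z : ℝ) :
    {x | x ∈ T.points α ∩ Metric.ball 0 r ∧ x + z ∈ T.points β}.ncard
      = ((Finset.range k).filter fun i : ℕ => T.letter (m + i) = α ∧
          T.pos (m + i) + z ∈ T.points β).card := by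
  have : {x | x ∈ T.points α ∩ Metric.ball 0 r ∧ x + z ∈ T.points β}
      = (fun i : ℕ => T.pos (m + i)) '' ((Finset.range k).filter fun i : ℕ =>
          T.letter (m + i) = α ∧ T.pos (m + i) + z ∈ T.points β : Finset ℕ) := by
    ext x
    simp only [Set.mem_ofPred_eq, Set.mem_inter_iff, Set.mem_image, Finset.mem_coe,
      Finset.mem_filter, Finset.mem_range]
    constructor
    · rintro ⟨⟨⟨n, hn, rfl⟩, hx⟩, hz⟩
      rw [h] at hx
      have hmn : m + ((n - m).toNat : ℕ) = n := by omega
      exact ⟨(n - m).toNat, ⟨by omega, by rwa [hmn], by rwa [hmn]⟩, by rw [hmn]⟩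
    · rintro ⟨i, ⟨hi, hα, hz⟩, rfl⟩
      exact ⟨⟨(T.mem_points_pos _ _).2 hα, (h _).2 (by omega)⟩, hz⟩
  rw [this, Set.ncard_image_of_injective, Set.ncard_coe_finset]
  intro i j hij
  have := T.pos_injective hij
  omega

/-- The frequency lets `x + z` leave the ball, whereas the word count does not. Positions grow by at
least `1` per index, so the extra pairs have first index within `⌈|z|⌉₊` of an end of the patch. -/
lemma abs_ncard_pairs_sub_pairCount_le
    (h : ∀ n, T.pos n ∈ Metric.ball 0 r ↔ m ≤ n ∧ n < m + k) (α β : Letter) (z : ℝ) :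
    |({x | x ∈ T.points α ∩ Metric.ball 0 r ∧ x + z ∈ T.points β}.ncard : ℝ)
      - pairCount α β z (T.word m k)| ≤ 2 * ⌈|z|⌉₊ := by
  classical
  rw [ncard_pairs h, pairCount_word]
  set A := (Finset.range k).filter fun i : ℕ => T.letter (m + i) = α ∧
    T.pos (m + i) + z ∈ T.points β
  set B := (Finset.range k).filter fun i : ℕ => T.letter (m + i) = α ∧
    ∃ j < k, T.letter (m + j) = β ∧ T.pos (m + j) = T.pos (m + i) + z
  set K := ⌈|z|⌉₊ with hK
  have hBA : B ⊆ A := by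
    intro i hi
    simp only [A, B, Finset.mem_filter] at hi ⊢
    obtain ⟨hi, hα, j, -, hj, hjz⟩ := hi
    exact ⟨hi, hα, m + j, hj, hjz⟩
  have hAB : A ⊆ B ∪ (Finset.range K ∪ Finset.Ico (k - K) k) := by
    intro i hi
    simp only [A, B, Finset.mem_filter, Finset.mem_union, Finset.mem_range, Finset.mem_Ico] at hi ⊢
    obtain ⟨hi, hα, n, hn, hnz⟩ := hi
    have hz : |z| ≤ K := Nat.le_ceil _
    by_cases hnm : m ≤ n ∧ n < m + k
    · have hmn : m + ((n - m).toNat : ℕ) = n := by omega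
      exact Or.inl ⟨hi, hα, (n - m).toNat, by omega, by rwa [hmn], by rwa [hmn]⟩
    · right
      rw [abs_le] at hz
      by_cases hlt : n < m
      · left
        have hd := T.sub_le_pos_sub (show n ≤ m + i by omega)
        have : ((m + i : ℤ) : ℝ) ≤ ((n + K : ℤ) : ℝ) := by
          rw [Int.cast_add n, Int.cast_natCast K]
          linarith
        have := Int.cast_le.1 this
        omega
      · right
        have hd := T.sub_le_pos_sub (show m + i ≤ n by omega)
        have : ((n : ℤ) : ℝ) ≤ ((m + i + K : ℤ) : ℝ) := by
          rw [Int.cast_add (m + i), Int.cast_natCast K]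
          linarith
        have := Int.cast_le.1 this
        omega
  have h1 := Finset.card_le_card hBA
  have h2 : A.card ≤ B.card + (K + K) := by
    refine (Finset.card_le_card hAB).trans ((Finset.card_union_le _ _).trans ?_)
    refine Nat.add_le_add_left ((Finset.card_union_le _ _).trans ?_) _
    rw [Finset.card_range, Nat.card_Ico]
    omega
  have h1' : (B.card : ℝ) ≤ A.card := by exact_mod_cast h1
  have h2' : (A.card : ℝ) ≤ B.card + (K + K) := by exact_mod_cast h2
  rw [abs_le]
  constructor <;> linarith [(Nat.cast_nonneg K : (0 : ℝ) ≤ K)]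

/-- The pair frequencies converge to the quotient of the density of the pair counts by the density
of points. -/
lemma tendsto_pairFreq (T : SigmaTiling) {α β : Letter} {z κ κ₀ : ℝ}
    (hκ : ∀ ε > 0, ∃ K, ∀ w, IsLegal w → K ≤ wordLength w →
      |pairCount α β z w - κ * wordLength w| ≤ ε * wordLength w)
    (hκ₀ : ∀ ε > 0, ∃ K, ∀ w, IsLegal w → K ≤ wordLength w →
      |(w.length : ℝ) - κ₀ * wordLength w| ≤ ε * wordLength w) (h0 : κ₀ ≠ 0) :
    Tendsto (T.pairFreq α β z) atTop (𝓝 (κ / κ₀)) := by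
  choose m k hb hL using T.exists_patch
  set W := fun r => T.word (m r) (k r) with hW
  have hlegal : ∀ r, IsLegal (W r) := fun r => T.legal (m r) (k r)
  have hLt : Tendsto (fun r => wordLength (W r)) atTop atTop := by
    refine tendsto_atTop_mono hL ?_
    exact tendsto_atTop_add_const_right _ _ (tendsto_id.const_mul_atTop (by norm_num))
  have hpos : ∀ᶠ r in atTop, 0 < wordLength (W r) := hLt.eventually_gt_atTop 0
  -- Patches of balls are legal words of unbounded length, so uniform densities become limits in
  -- `r`.
  have key : ∀ (F : List Letter → ℝ) (c : ℝ), (∀ ε > 0, ∃ K, ∀ w, IsLegal w → K ≤ wordLength w →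
      |F w - c * wordLength w| ≤ ε * wordLength w) →
      Tendsto (fun r => F (W r) / wordLength (W r)) atTop (𝓝 c) := by
    intro F c hF
    rw [Metric.tendsto_nhds]
    intro ε hε
    obtain ⟨K, hK⟩ := hF (ε / 2) (by positivity)
    filter_upwards [hLt.eventually_ge_atTop K, hpos] with r hr hp
    have hd := hK _ (hlegal r) hr
    have e : F (W r) / wordLength (W r) - c
        = (F (W r) - c * wordLength (W r)) / wordLength (W r) := by field_simp
    rw [Real.dist_eq, e, abs_div, abs_of_pos hp, div_lt_iff₀ hp]
    nlinarith
  have hden := key _ _ hκ₀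
  have hnum : Tendsto (fun r =>
      ({x | x ∈ T.points α ∩ Metric.ball 0 r ∧ x + z ∈ T.points β}.ncard : ℝ)
        / wordLength (W r)) atTop (𝓝 κ) := by
    have hdiff : Tendsto (fun r =>
        (({x | x ∈ T.points α ∩ Metric.ball 0 r ∧ x + z ∈ T.points β}.ncard : ℝ)
          - pairCount α β z (W r)) / wordLength (W r)) atTop (𝓝 0) := by
      refine squeeze_zero_norm' (a := fun r => 2 * ⌈|z|⌉₊ / wordLength (W r)) ?_
        (hLt.const_div_atTop _)
      filter_upwards [hpos] with r hp
      rw [Real.norm_eq_abs, abs_div, abs_of_pos hp]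
      exact div_le_div_of_nonneg_right (abs_ncard_pairs_sub_pairCount_le (hb r) α β z) hp.le
    have := hdiff.add (key _ _ hκ)
    rw [zero_add] at this
    refine this.congr fun r => ?_
    rw [← add_div, sub_add_cancel]
  refine (hnum.div hden h0).congr' ?_
  filter_upwards [hpos] with r hp
  rw [Pi.div_apply, pairFreq, ncard_allPoints_inter (hb r), hW, length_word]
  exact div_div_div_cancel_right₀ hp.ne' _ _

lemma pairFreq_eq_zero (T : SigmaTiling) {α β : Letter} {z : ℝ}
    (hz : z ∉ T.points β - T.points α) (r : ℝ) : T.pairFreq α β z r = 0 := by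
  have : {x | x ∈ T.points α ∩ Metric.ball 0 r ∧ x + z ∈ T.points β} = ∅ := by
    refine Set.eq_empty_of_forall_notMem fun x hx => hz ?_
    exact ⟨x + z, hx.2, x, hx.1.1, add_sub_cancel_left x z⟩
  rw [pairFreq, this]
  simp

end SigmaTiling

/-! ### Pair correlations and the theorem -/

/-- The density of points is positive. -/
lemma pos_of_tendsto_length {κ₀ : ℝ}
    (h : ∀ c, Tendsto (fun n => ((sigmaWord^[n] [c]).length : ℝ) / (lam ^ 2) ^ n) atTop
      (𝓝 (κ₀ * tileLength c))) : 0 < κ₀ := by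
  have hl := lam_pos
  have hb := h .b
  rw [tileLength, mul_one] at hb
  refine lt_of_lt_of_le (inv_pos.2 hl) (ge_of_tendsto' hb fun n => ?_)
  have h1 := wordLength_le (sigmaWord^[n] [.b])
  rw [wordLength_iterate] at h1
  simp only [wordLength_cons, wordLength_nil, tileLength, add_zero, mul_one] at h1
  rw [le_div_iff₀ (by positivity), inv_mul_le_iff₀ hl]
  exact h1

/-- The pair correlations exist, are the same for all tilings, and satisfy the renormalisation
equations. -/
theorem exists_pairCorrelation : ∃ ν : Letter → Letter → ℝ → ℝ,
    (∀ (T : SigmaTiling) (α β : Letter) (z : ℝ),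
      Tendsto (T.pairFreq α β z) atTop (𝓝 (ν α β z))) ∧
    (∀ (α β : Letter) (z : ℝ), lam ^ 2 * ν α β z =
      ((occurrences α).map fun e => ((occurrences β).map fun e' =>
        ν e.1 e'.1 ((z + e.2 - e'.2) / lam ^ 2)).sum).sum) ∧
    ∀ (α β : Letter) (z : ℝ), ν β α z = ν α β (-z) := by
  choose κ hκ hκ' using fun α β z => (almostAdditive_pairCount α β z).exists_density
  obtain ⟨κ₀, h₀, h₀'⟩ := almostAdditive_length.exists_density
  have hpos := pos_of_tendsto_length h₀
  -- The tile `b` has length `1`, so its supertiles give the density itself.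
  have hκb : ∀ α β z, Tendsto (fun n => pairCount α β z (sigmaWord^[n] [.b]) / (lam ^ 2) ^ n)
      atTop (𝓝 (κ α β z)) := fun α β z => by simpa [tileLength] using hκ α β z .b
  refine ⟨fun α β z => κ α β z / κ₀,
    fun T α β z => T.tendsto_pairFreq (hκ' α β z) h₀' hpos.ne', fun α β z => ?_, fun α β z => ?_⟩
  · rw [← mul_div_assoc, density_renormalisation hκb α β z]
    simp only [div_eq_mul_inv _ κ₀, List.sum_map_mul_right]
  · refine congrArg (· / κ₀) ?_
    refine tendsto_nhds_unique (hκb β α z) ((hκb α β (-z)).congr fun n => ?_)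
    rw [← pairCount_comm]

theorem mainTheorem3 :
    -- the Perron-Frobenius eigenvalue of the substitution matrix, with the tile lengths as
    -- positive left eigenvector
    lam ^ 2 = 3 + 2 * √2 ∧
    (∀ α : Letter, 0 < tileLength α) ∧
    Matrix.vecMul tileLength sigmaMatrix = lam ^ 2 • tileLength ∧
    (∀ μ : ℂ, Module.End.HasEigenvalue
        (Matrix.toLin' (sigmaMatrix.map (fun x : ℝ => (x : ℂ)))) μ →
      μ ≠ ((lam ^ 2 : ℝ) : ℂ) → ‖μ‖ < lam ^ 2) ∧
    -- such tilings exist, and every one of them has the stated pair correlations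
    Nonempty SigmaTiling ∧
    ∀ T : SigmaTiling,
        (∀ (α β : Letter) (z : ℝ),
          Filter.Tendsto (T.pairFreq α β z) Filter.atTop (nhds (T.nu α β z))) ∧
        (∀ z : ℝ, lam ^ 2 * T.nu .a .a z =
          5 * T.nu .a .a (z / lam ^ 2) + 4 * T.nu .a .a ((z - lam) / lam ^ 2) +
          4 * T.nu .a .a ((z + lam) / lam ^ 2) + 3 * T.nu .a .a ((z - 2 * lam) / lam ^ 2) +
          T.nu .b .b ((z + lam) / lam ^ 2) + 3 * T.nu .a .a ((z + 2 * lam) / lam ^ 2) +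
          2 * T.nu .a .a ((z - 3 * lam) / lam ^ 2) + 2 * T.nu .a .a ((z + 3 * lam) / lam ^ 2) +
          T.nu .a .a ((z - 4 * lam) / lam ^ 2) + T.nu .a .a ((z + 4 * lam) / lam ^ 2) +
          2 * T.nu .a .b ((z - 1) / lam ^ 2) + 2 * T.nu .b .a ((z + 1) / lam ^ 2) +
          T.nu .a .b ((z - lam - 1) / lam ^ 2) + T.nu .b .a ((z + lam + 1) / lam ^ 2) +
          T.nu .a .b ((z + 4 * lam - 1) / lam ^ 2) + T.nu .b .a ((z - 4 * lam + 1) / lam ^ 2) +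
          T.nu .b .b ((z - lam) / lam ^ 2) + 2 * T.nu .a .b ((z + lam - 1) / lam ^ 2) +
          2 * T.nu .b .a ((z - lam + 1) / lam ^ 2) + 2 * T.nu .a .b ((z + 2 * lam - 1) / lam ^ 2) +
          2 * T.nu .b .b (z / lam ^ 2) + 2 * T.nu .b .a ((z - 2 * lam + 1) / lam ^ 2) +
          2 * T.nu .a .b ((z + 3 * lam - 1) / lam ^ 2) + 2 * T.nu .b .a ((z - 3 * lam + 1) / lam ^ 2)) ∧
        (∀ z : ℝ, lam ^ 2 * T.nu .b .b z =
          2 * T.nu .a .a (z / lam ^ 2) + T.nu .a .a ((z - 1) / lam ^ 2) +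
          T.nu .a .b ((z + 5 * lam) / lam ^ 2) + T.nu .a .a ((z + 1) / lam ^ 2) +
          T.nu .a .b ((z + 5 * lam + 1) / lam ^ 2) + T.nu .b .a ((z - 5 * lam) / lam ^ 2) +
          T.nu .b .a ((z - 5 * lam - 1) / lam ^ 2) + T.nu .b .b (z / lam ^ 2)) ∧
        (∀ z : ℝ, lam ^ 2 * T.nu .a .b z =
          T.nu .a .a ((z - 5 * lam) / lam ^ 2) + T.nu .a .a ((z - 5 * lam - 1) / lam ^ 2) +
          T.nu .a .b (z / lam ^ 2) + T.nu .a .a ((z - 4 * lam) / lam ^ 2) +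
          T.nu .b .a ((z - 4 * lam) / lam ^ 2) + T.nu .a .a ((z - 4 * lam - 1) / lam ^ 2) +
          T.nu .a .b ((z + lam) / lam ^ 2) + T.nu .a .a ((z - 3 * lam) / lam ^ 2) +
          T.nu .a .a ((z - 3 * lam - 1) / lam ^ 2) + T.nu .a .b ((z + 2 * lam) / lam ^ 2) +
          T.nu .a .a ((z - 2 * lam) / lam ^ 2) + T.nu .a .a ((z - 2 * lam - 1) / lam ^ 2) +
          T.nu .a .b ((z + 3 * lam) / lam ^ 2) + T.nu .a .a ((z - lam) / lam ^ 2) +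
          T.nu .a .a ((z - lam - 1) / lam ^ 2) + T.nu .a .b ((z + 4 * lam) / lam ^ 2) +
          T.nu .b .a ((z + 1 - 5 * lam) / lam ^ 2) + T.nu .b .a ((z - 5 * lam) / lam ^ 2) +
          T.nu .b .b ((z + 1) / lam ^ 2) + T.nu .b .a ((z + 1 - 4 * lam) / lam ^ 2) +
          T.nu .b .b ((z + lam + 1) / lam ^ 2)) ∧
        (∀ z : ℝ, T.nu .b .a z = T.nu .a .b (-z)) ∧
        (∀ (α β : Letter) (z : ℝ),
          z ∉ T.points β - T.points α → T.nu α β z = 0) := by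
  obtain ⟨ν, hν, hren, hsymm⟩ := exists_pairCorrelation
  refine ⟨?_, fun α => lt_of_lt_of_le one_pos (one_le_tileLength α), vecMul_tileLength,
    fun μ => norm_lt_of_hasEigenvalue, nonempty_sigmaTiling, fun T => ?_⟩
  · rw [lam_sq, lam]
    ring
  have hnu : ∀ α β z, T.nu α β z = ν α β z := fun α β z => (hν T α β z).limUnder_eq
  simp only [hnu]
  refine ⟨fun α β z => hν T α β z, fun z => ?_, fun z => ?_, fun z => ?_, hsymm .a .b,
    fun α β z hz => ?_⟩
  · rw [hren]
    simp only [occurrences, List.map_cons, List.map_nil, List.sum_cons, List.sum_nil]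
    -- With the denominator an atom, `ring_nf` normalises the arguments of `ν` without mixing it
    -- with the `λ` in the offsets.
    generalize lam ^ 2 = q
    ring_nf
  · rw [hren]
    simp only [occurrences, List.map_cons, List.map_nil, List.sum_cons, List.sum_nil]
    generalize lam ^ 2 = q
    ring_nf
  · rw [hren]
    simp only [occurrences, List.map_cons, List.map_nil, List.sum_cons, List.sum_nil]
    generalize lam ^ 2 = q
    ring_nf
  · refine tendsto_nhds_unique (hν T α β z) ?_
    simp only [funext (T.pairFreq_eq_zero hz)]
    exact tendsto_const_nhds
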